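/- Let $G$ be a finite group and let $H \le G$ be a subgroup which is isomorphic to the permutation group $$\langle (1,2,3),\ (4,5,6),\ (7,8,9),\ (1,2)(4,5),\ (1,2)(7,8)\rangle$$ (a group of shape $3^3{:}2^2$ and order $108$). Let $T$ be a Sylow $3$-subgroup of $H$, and assume that $N_G(T) = H$ and that $C_G(t) \le H$ for every non-identity element $t \in T$. Then $G = H$. -/

import Mathlib

/-- The permutation group `⟨(1,2,3), (4,5,6), (7,8,9), (1,2)(4,5), (1,2)(7,8)⟩`, of shape `3^3:2^2`,
on nine points; the points `1, …, 9` are written `0, …, 8`. -/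
def modelGroup : Subgroup (Equiv.Perm (Fin 9)) :=
  Subgroup.closure
    {c[0, 1, 2], c[3, 4, 5], c[6, 7, 8], c[0, 1] * c[3, 4], c[0, 1] * c[6, 7]}

/-!
The proof compares an upper and a lower bound for the order of `G`.

By the centralizer condition and `N_G(T) = H`, the subgroup `T` meets its other conjugates
trivially, and if `g ∉ H` then `T * g * H` already has `27 * 108 = 2916` elements
(`le_card_of_notMem`).

For the upper bound, let `α` be the class function of `G` induced from `λ - λ⁻¹`, where `λ` is the
linear character `(1, 1, 1)` of `T = 3³`. As `λ` and `λ⁻¹` are not conjugate under `H`, induction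
gives `α` norm `2`, so `α = χ - χ'` with irreducible `χ` and `χ'`. As `α` vanishes at `1`, they have
the same degree `d`. Hence the convolution of `α` with itself is `|G| / d * (χ + χ')`, and for every
generalized character `γ`, with `m` the multiplicity of `χ` and `χ'` in `γ` together, the
convolution of `α`, `α` and `γ` has at `1` the value `|G| ^ 2 * m / d`.

On the other hand this value counts, with weights, triples of elements with product `1`, all of
order `3` if `γ` is induced from a function on `T` that vanishes at `1`. The triangle group
`(3, 3, 3)` has an abelian normal subgroup of index `3`, and it follows that the members of such a
triple either lie together in a conjugate of `T` or are conjugate in `G`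
(`mem_or_isConj_of_pow_three`). If `γ` vanishes where `α` does not, only the triples of the first
kind count, and the sum is the one in `H`. There is such a `γ` (`gammaSeed`), and a computation with
sums over `T` gives `|G| * m = 54 * d`. Therefore `|G| ≤ 54 * d`, and `2 * d ^ 2 ≤ |G|` implies
`|G| ≤ 54 ^ 2 / 2 = 1458 < 2916`.

Characters appear through the Wedderburn decomposition of `ℂ[G]`: an induced class function is the
sum `conjSum` of the conjugates of an element supported on `T`, multiplicities are traces of
idempotents, and orthogonality is the formula for the regular trace in `exists_matrix_family`.
-/

/-! ### The group algebra and its irreducible representations -/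

theorem trace_mulLeft_matrix {n : Type*} [Fintype n] [DecidableEq n] (A : Matrix n n ℂ) :
    LinearMap.trace ℂ (Matrix n n ℂ) (LinearMap.mulLeft ℂ A) = Fintype.card n * A.trace := by
  rw [LinearMap.trace_eq_matrix_trace ℂ (Matrix.stdBasis ℂ n n), Matrix.trace,
    Fintype.sum_prod_type]
  have h : ∀ i j, (LinearMap.toMatrix (Matrix.stdBasis ℂ n n) (Matrix.stdBasis ℂ n n)
      (LinearMap.mulLeft ℂ A)).diag (i, j) = A i i := by
    intro i j
    rw [Matrix.diag_apply, LinearMap.toMatrix_apply, LinearMap.mulLeft_apply,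
      Matrix.stdBasis_eq_single]
    have : ∀ B : Matrix n n ℂ, (Matrix.stdBasis ℂ n n).repr B (i, j) = B i j := by
      intro B
      simp [Matrix.stdBasis, Pi.basis_repr]
    rw [this]
    simp
  simp only [h, Finset.sum_const, Finset.card_univ, nsmul_eq_mul, ← Finset.mul_sum]
  rfl

/-- The trace of a block diagonal map is the sum of the traces of its blocks. -/
theorem trace_pi_map {ι : Type*} [Fintype ι] [DecidableEq ι] {M : ι → Type*}
    [∀ i, AddCommGroup (M i)] [∀ i, Module ℂ (M i)] [∀ i, FiniteDimensional ℂ (M i)]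
    (f : ∀ i, M i →ₗ[ℂ] M i) :
    LinearMap.trace ℂ (∀ i, M i) (LinearMap.pi fun i => f i ∘ₗ LinearMap.proj i) =
      ∑ i, LinearMap.trace ℂ (M i) (f i) := by
  let b : ∀ i, Module.Basis _ ℂ (M i) := fun i => Module.finBasis ℂ (M i)
  rw [LinearMap.trace_eq_matrix_trace ℂ (Pi.basis b), Matrix.trace, Fintype.sum_sigma]
  refine Finset.sum_congr rfl fun i _ => ?_
  rw [LinearMap.trace_eq_matrix_trace ℂ (b i), Matrix.trace]
  refine Finset.sum_congr rfl fun j _ => ?_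
  simp [LinearMap.toMatrix_apply, Pi.basis_repr, Pi.basis_apply]

theorem trace_mulLeft_monoidAlgebra {G : Type*} [Group G] [Finite G] (a : MonoidAlgebra ℂ G) :
    LinearMap.trace ℂ (MonoidAlgebra ℂ G) (LinearMap.mulLeft ℂ a) = Nat.card G * a.coeff 1 := by
  classical
  cases nonempty_fintype G
  let b : Module.Basis G ℂ (MonoidAlgebra ℂ G) := MonoidAlgebra.basis G ℂ
  rw [LinearMap.trace_eq_matrix_trace ℂ b, Matrix.trace]
  have h : ∀ x, (LinearMap.toMatrix b b (LinearMap.mulLeft ℂ a)).diag x = a.coeff 1 := by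
    intro x
    rw [Matrix.diag_apply, LinearMap.toMatrix_apply, LinearMap.mulLeft_apply,
      MonoidAlgebra.basis_apply]
    change (a * MonoidAlgebra.single x 1).coeff x = _
    rw [MonoidAlgebra.coeff_mul_single_apply, mul_inv_cancel, mul_one]
  rw [Finset.sum_congr rfl fun x _ => h x, Finset.sum_const, Finset.card_univ, nsmul_eq_mul,
    Nat.card_eq_fintype_card]

/-- Wedderburn's theorem for `ℂ[G]`, with the trace of the regular representation: the irreducible
matrix representations `R i` of degrees `d i` recover the coefficient of an element at `1`. This
formula replaces the orthogonality relations of characters. -/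
theorem exists_matrix_family (G : Type*) [Group G] [Finite G] :
    ∃ (n : ℕ) (d : Fin n → ℕ)
      (R : ∀ i, MonoidAlgebra ℂ G →ₐ[ℂ] Matrix (Fin (d i)) (Fin (d i)) ℂ),
      (∀ i, 0 < d i) ∧ (∀ i, Function.Surjective (R i)) ∧
      ∀ a, Nat.card G * a.coeff 1 = ∑ i, d i * (R i a).trace := by
  classical
  have hG : NeZero (Nat.card G : ℂ) := ⟨Nat.cast_ne_zero.2 Nat.card_pos.ne'⟩
  have : FiniteDimensional ℂ (MonoidAlgebra ℂ G) := Module.Basis.finiteDimensional_of_finite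
    (MonoidAlgebra.basis G ℂ)
  obtain ⟨n, d, hd, ⟨e⟩⟩ :=
    IsSemisimpleRing.exists_algEquiv_pi_matrix_of_isAlgClosed ℂ (MonoidAlgebra ℂ G)
  refine ⟨n, d, fun i => (Pi.evalAlgHom ℂ _ i).comp e.toAlgHom, fun i => (hd i).pos, fun i x => ?_,
    fun a => ?_⟩
  · obtain ⟨y, hy⟩ := e.surjective (Pi.single i x)
    exact ⟨y, by simp [hy]⟩
  · rw [← trace_mulLeft_monoidAlgebra, ← LinearMap.trace_conj' _ e.toLinearEquiv]
    have h : e.toLinearEquiv.conj (LinearMap.mulLeft ℂ a) =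
        LinearMap.pi fun i => LinearMap.mulLeft ℂ (e a i) ∘ₗ LinearMap.proj i := by
      refine LinearMap.ext fun x => ?_
      change e (a * e.symm x) = _
      rw [map_mul, e.apply_symm_apply]
      rfl
    rw [h, trace_pi_map]
    refine Finset.sum_congr rfl fun i _ => ?_
    rw [trace_mulLeft_matrix, Fintype.card_fin]
    rfl

/-- The sum of all conjugates of an element of `ℂ[G]`, a central element. If the
coefficients of `a` are `θ / |T|` on a subgroup `T` and zero elsewhere, for a linear character `θ`
of `T`, then the coefficients of `conjSum a` are the values of the character induced from `θ`. -/
noncomputable def conjSum {G : Type*} [Group G] [Fintype G] (a : MonoidAlgebra ℂ G) :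
    MonoidAlgebra ℂ G :=
  ∑ g : G, MonoidAlgebra.single g 1 * a * MonoidAlgebra.single g⁻¹ 1

section

variable {G : Type*} [Group G] [Fintype G]

theorem coeff_conjSum (a : MonoidAlgebra ℂ G) (z : G) :
    (conjSum a).coeff z = ∑ g : G, a.coeff (g⁻¹ * z * g) := by
  simp [conjSum, MonoidAlgebra.coeff_sum, Finsupp.finsetSum_apply, mul_assoc]

theorem commute_single_conjSum (a : MonoidAlgebra ℂ G) (g : G) :
    Commute (MonoidAlgebra.single g 1) (conjSum a) := by
  change _ * _ = _ * _
  rw [conjSum, Finset.mul_sum, Finset.sum_mul, ← Equiv.sum_comp (Equiv.mulLeft g)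
    (fun x => MonoidAlgebra.single x 1 * a * MonoidAlgebra.single x⁻¹ 1 * MonoidAlgebra.single g 1)]
  refine Finset.sum_congr rfl fun x _ => ?_
  simp [mul_assoc, MonoidAlgebra.single_mul_single]
  simp [← mul_assoc, MonoidAlgebra.single_mul_single]

theorem commute_conjSum (a b : MonoidAlgebra ℂ G) : Commute b (conjSum a) := by
  induction b using MonoidAlgebra.induction_linear with
  | zero => exact Commute.zero_left _
  | add x y hx hy => exact hx.add_left hy
  | single g r =>
    have : (MonoidAlgebra.single g r : MonoidAlgebra ℂ G) = r • MonoidAlgebra.single g 1 := by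
      simp
    rw [this]
    exact (commute_single_conjSum a g).smul_left r

theorem trace_map_conjSum {n : Type*} [Fintype n] [DecidableEq n]
    (R : MonoidAlgebra ℂ G →ₐ[ℂ] Matrix n n ℂ) (a : MonoidAlgebra ℂ G) :
    (R (conjSum a)).trace = Fintype.card G * (R a).trace := by
  have h : ∀ g : G, (R (MonoidAlgebra.single g 1 * a * MonoidAlgebra.single g⁻¹ 1)).trace =
      (R a).trace := by
    intro g
    rw [map_mul, map_mul, Matrix.trace_mul_cycle, ← map_mul R (MonoidAlgebra.single g⁻¹ 1),
      MonoidAlgebra.single_mul_single, inv_mul_cancel, mul_one, ← MonoidAlgebra.one_def, map_one,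
      one_mul]
  rw [conjSum, map_sum, Matrix.trace_sum, Finset.sum_congr rfl fun g _ => h g]
  simp

/-- Schur's lemma: an irreducible representation maps the central element `conjSum a` to a scalar,
which is determined by the trace. -/
theorem map_conjSum {n : Type*} [Fintype n] [DecidableEq n] [Nonempty n]
    {R : MonoidAlgebra ℂ G →ₐ[ℂ] Matrix n n ℂ} (hR : Function.Surjective R)
    (a : MonoidAlgebra ℂ G) :
    R (conjSum a) = (Fintype.card G * (R a).trace / Fintype.card n : ℂ) • 1 := by
  have h : R (conjSum a) ∈ Set.center (Matrix n n ℂ) := by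
    rw [Semigroup.mem_center_iff]
    intro x
    obtain ⟨y, rfl⟩ := hR x
    exact (commute_conjSum a y).map R
  obtain ⟨c, hc⟩ : ∃ c : ℂ, R (conjSum a) = c • 1 := by
    rw [Matrix.center_eq_scalar_image] at h
    obtain ⟨c, -, hc⟩ := h
    exact ⟨c, by rw [← hc, Matrix.smul_one_eq_diagonal]; rfl⟩
  have h1 := trace_map_conjSum R a
  rw [hc, Matrix.trace_smul, Matrix.trace_one, smul_eq_mul] at h1
  have : (Fintype.card n : ℂ) ≠ 0 := Nat.cast_ne_zero.2 Fintype.card_ne_zero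
  rw [hc, ← h1, mul_div_cancel_right₀ _ this]

end

/-- Idempotents have trace equal to their rank. This is the source of integrality: applied to the
idempotent of a linear character it says that multiplicities are integers. -/
theorem exists_int_trace {G : Type*} [Group G] {n : Type*} [Fintype n] [DecidableEq n]
    (R : MonoidAlgebra ℂ G →ₐ[ℂ] Matrix n n ℂ) {a : MonoidAlgebra ℂ G}
    (ha : a ∈ AddSubgroup.closure {e : MonoidAlgebra ℂ G | IsIdempotentElem e}) :
    ∃ m : ℤ, (R a).trace = m := by
  induction ha using AddSubgroup.closure_induction with
  | mem e he =>
    have h : IsIdempotentElem (Matrix.toLin' (R e)) := by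
      rw [IsIdempotentElem, Module.End.mul_eq_comp, ← Matrix.toLin'_mul, ← map_mul, he]
    refine ⟨Module.finrank ℂ (LinearMap.range (Matrix.toLin' (R e))), ?_⟩
    rw [← Matrix.trace_toLin'_eq, (LinearMap.IsIdempotentElem.isProj_range _ h).trace]
    simp
  | zero => exact ⟨0, by simp⟩
  | add x y _ _ hx hy =>
    obtain ⟨k, hk⟩ := hx
    obtain ⟨l, hl⟩ := hy
    exact ⟨k + l, by simp [hk, hl]⟩
  | neg x _ hx =>
    obtain ⟨k, hk⟩ := hx
    exact ⟨-k, by simp [hk]⟩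

/-! ### A bound from central elements of the group algebra -/

/-- Integers whose squares sum to `2` are zero except for two of them, each `1` or `-1`. -/
theorem exists_pair_of_sum_sq_eq_two {ι : Type*} [Fintype ι] [DecidableEq ι] {ν : ι → ℤ}
    (h : ∑ i, ν i ^ 2 = 2) :
    ∃ i j, i ≠ j ∧ ν i ^ 2 = 1 ∧ ν j ^ 2 = 1 ∧ ∀ k, k ≠ i ∧ k ≠ j → ν k = 0 := by
  have key : ∀ (s : Finset ι) (m : ℤ), 0 < m → m ≤ 2 → ∑ i ∈ s, ν i ^ 2 = m →
      ∃ i ∈ s, ν i ^ 2 = 1 := by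
    intro s m hm hm2 hs
    obtain ⟨i, hi, hne⟩ : ∃ i ∈ s, ν i ^ 2 ≠ 0 := by
      by_contra! hcon
      rw [Finset.sum_eq_zero hcon] at hs
      exact hm.ne hs
    have hle : ν i ^ 2 ≤ 2 := by
      refine le_trans ?_ (hs.trans_le hm2)
      exact Finset.single_le_sum (f := fun i => ν i ^ 2) (fun _ _ => sq_nonneg _) hi
    refine ⟨i, hi, ?_⟩
    have h1 : ν i ≤ 1 := by nlinarith
    have h2 : -1 ≤ ν i := by nlinarith
    interval_cases h3 : ν i <;> simp_all
  obtain ⟨i, -, hi⟩ := key _ 2 two_pos le_rfl h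
  have h1 := Finset.add_sum_erase Finset.univ (fun i => ν i ^ 2) (Finset.mem_univ i)
  rw [h, hi] at h1
  obtain ⟨j, hj, hj1⟩ := key (Finset.univ.erase i) 1 one_pos one_le_two (by linarith)
  have h2 := Finset.add_sum_erase (Finset.univ.erase i) (fun i => ν i ^ 2) hj
  have h3 : ∑ k ∈ (Finset.univ.erase i).erase j, ν k ^ 2 = 0 := by simp only [hj1] at h2; linarith
  rw [Finset.sum_eq_zero_iff_of_nonneg fun _ _ => sq_nonneg _] at h3
  refine ⟨i, j, (Finset.ne_of_mem_erase hj).symm, hi, hj1, fun k hk => ?_⟩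
  simpa using h3 k (by simp [hk.1, hk.2])

/-- A bound for `|G|`. Let `ν i` and `μ i` be the traces of `u` and `c` in the irreducible
representation of degree `d i`; they are integers. The hypotheses on coefficients read
`∑ d i * ν i = 0`, `∑ ν i ^ 2 = 2` and `|G| * ∑ ν i ^ 2 * μ i / d i = N`. So exactly two `ν i` are
nonzero, they are `1` and `-1`, the two degrees have a common value `d`, and `|G| * m = N * d` for a
positive integer `m`. Now `|G| ≤ N * d` and `2 * d ^ 2 ≤ |G|` give the bound. -/
theorem two_mul_card_le_sq {G : Type*} [Group G] [Fintype G] {u c : MonoidAlgebra ℂ G}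
    (hu : u ∈ AddSubgroup.closure {e : MonoidAlgebra ℂ G | IsIdempotentElem e})
    (hc : c ∈ AddSubgroup.closure {e : MonoidAlgebra ℂ G | IsIdempotentElem e})
    (h1 : u.coeff 1 = 0) (h2 : (u * conjSum u).coeff 1 = 2) {N : ℕ} (hN : 0 < N)
    (h3 : (u * (conjSum u * conjSum c)).coeff 1 = N) :
    2 * Fintype.card G ≤ N ^ 2 := by
  obtain ⟨n, d, R, hd, hR, htr⟩ := exists_matrix_family G
  rw [Nat.card_eq_fintype_card] at htr
  set g := Fintype.card G with hg
  have hg0 : (g : ℂ) ≠ 0 := Nat.cast_ne_zero.2 Fintype.card_ne_zero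
  have hd0 : ∀ i, (d i : ℂ) ≠ 0 := fun i => Nat.cast_ne_zero.2 (hd i).ne'
  have hne : ∀ i, Nonempty (Fin (d i)) := fun i => ⟨⟨0, hd i⟩⟩
  choose ν hν using fun i => exists_int_trace (R i) hu
  choose μ hμ using fun i => exists_int_trace (R i) hc
  have hU : ∀ i, R i (conjSum u) = ((g : ℂ) * ν i / d i) • 1 := fun i => by
    rw [map_conjSum (hR i), hν, Fintype.card_fin]
  have hC : ∀ i, R i (conjSum c) = ((g : ℂ) * μ i / d i) • 1 := fun i => by
    rw [map_conjSum (hR i), hμ, Fintype.card_fin]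
  -- The sum of the squares of the degrees, from the trace formula at the identity.
  have hdeg : ∑ i, d i ^ 2 = g := by
    have := htr 1
    simp only [map_one, Matrix.trace_one, Fintype.card_fin] at this
    rw [MonoidAlgebra.one_def, MonoidAlgebra.coeff_single, Finsupp.single_eq_same, mul_one] at this
    have h : ((∑ i, d i ^ 2 : ℕ) : ℂ) = (g : ℂ) := by
      rw [this]; push_cast; exact Finset.sum_congr rfl fun i _ => sq _
    exact_mod_cast h
  have hdν : ∑ i, (d i : ℤ) * ν i = 0 := by
    have := htr u
    rw [h1, mul_zero] at this
    have h : ((∑ i, (d i : ℤ) * ν i : ℤ) : ℂ) = 0 := by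
      rw [this]; push_cast; exact Finset.sum_congr rfl fun i _ => by rw [hν]
    exact_mod_cast h
  have hνν : ∑ i, ν i ^ 2 = 2 := by
    have := htr (u * conjSum u)
    rw [h2] at this
    have h : ((∑ i, ν i ^ 2 : ℤ) : ℂ) = 2 := by
      refine mul_left_cancel₀ hg0 ?_
      rw [this, Int.cast_sum, Finset.mul_sum]
      refine Finset.sum_congr rfl fun i _ => ?_
      rw [map_mul, hU, mul_smul_comm, mul_one, Matrix.trace_smul, hν, smul_eq_mul]
      have := hd0 i
      field_simp
      push_cast
      ring
    exact_mod_cast h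
  have hνμ : (g : ℂ) * ∑ i, (ν i : ℂ) ^ 2 * μ i / d i = N := by
    have := htr (u * (conjSum u * conjSum c))
    rw [h3] at this
    refine mul_left_cancel₀ hg0 ?_
    rw [this, Finset.mul_sum, Finset.mul_sum]
    refine Finset.sum_congr rfl fun i _ => ?_
    rw [map_mul, map_mul, hU, hC, smul_mul_smul_comm, mul_one, mul_smul_comm, mul_one,
      Matrix.trace_smul, hν, smul_eq_mul]
    have := hd0 i
    field_simp
  obtain ⟨i, j, hij, hi, hj, hk⟩ := exists_pair_of_sum_sq_eq_two hνν
  have hdd : d i = d j := by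
    rw [Fintype.sum_eq_add i j hij fun k h => by rw [hk k h, mul_zero]] at hdν
    have h4 : (d i : ℤ) ^ 2 = (d j : ℤ) ^ 2 := by
      have : (d i : ℤ) * ν i = - (d j * ν j) := by linarith
      calc (d i : ℤ) ^ 2 = ((d i : ℤ) * ν i) ^ 2 := by rw [mul_pow, hi, mul_one]
        _ = (d j : ℤ) ^ 2 := by rw [this, neg_sq, mul_pow, hj, mul_one]
    have h5 := (sq_eq_sq₀ (Int.natCast_nonneg _) (Int.natCast_nonneg _)).1 h4
    exact_mod_cast h5
  have hm : (g : ℤ) * (μ i + μ j) = N * d i := by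
    rw [Fintype.sum_eq_add i j hij fun k h => by rw [hk k h]; simp] at hνμ
    have hi' : (ν i : ℂ) ^ 2 = 1 := by exact_mod_cast hi
    have hj' : (ν j : ℂ) ^ 2 = 1 := by exact_mod_cast hj
    rw [hi', hj', ← hdd, one_mul, one_mul] at hνμ
    have := hd0 i
    field_simp at hνμ
    rw [mul_comm (N : ℤ)]
    exact_mod_cast hνμ
  have hgpos : 0 < (g : ℤ) := by exact_mod_cast Fintype.card_pos
  have hmpos : 0 < μ i + μ j := by
    have : 0 < (N : ℤ) * d i := by exact_mod_cast Nat.mul_pos hN (hd i)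
    rw [← hm] at this
    exact pos_of_mul_pos_right this hgpos.le
  have hle : g ≤ N * d i := by
    have : (g : ℤ) ≤ N * d i := by rw [← hm]; nlinarith
    exact_mod_cast this
  have hsq : 2 * d i ^ 2 ≤ g := by
    rw [← hdeg]
    calc 2 * d i ^ 2 = ∑ k ∈ {i, j}, d k ^ 2 := by rw [Finset.sum_pair hij, ← hdd, two_mul]
      _ ≤ _ := Finset.sum_le_sum_of_subset (Finset.subset_univ _)
  have hgp : 0 < g := Fintype.card_pos
  refine Nat.le_of_mul_le_mul_right (c := g) ?_ hgp
  calc 2 * g * g ≤ 2 * ((N * d i) * (N * d i)) := by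
        rw [mul_assoc]; exact Nat.mul_le_mul_left 2 (Nat.mul_le_mul hle hle)
    _ = N ^ 2 * (2 * d i ^ 2) := by ring
    _ ≤ N ^ 2 * g := Nat.mul_le_mul_left _ hsq

/-! ### Triples of elements of order three with product one -/

section

variable {G : Type*} [Group G]

/-- The triangle group `(3, 3, 3)` is `ℤ² : 3`. So if `x`, `y` and `x * y` have cube `1`, then
`p = x⁻¹ * y` and its conjugate `q` under `x` commute, and `p`, `q` and the next conjugate of `p`
have product `1`. If the order of `p` is prime to `3`, then `1 - σ`, where `σ` is conjugation by `x`, is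
invertible on `⟨p, q⟩`, which makes all elements of the coset of `x` conjugate. Otherwise `x` acts
on the nontrivial `3`-group of elements of order dividing `3` in `⟨p, q⟩` and fixes a nontrivial
element. -/
theorem exists_conj_or_commute [Finite G] {x y : G} (hx : x ^ 3 = 1) (hy : y ^ 3 = 1)
    (hxy : (x * y) ^ 3 = 1) :
    IsConj x (x * y)⁻¹ ∨ ∃ c ≠ 1, c ^ 3 = 1 ∧ Commute c x ∧ Commute c (x⁻¹ * y) := by
  have hx2 : x⁻¹ = x * x := (eq_inv_of_mul_eq_one_left (by rw [← hx, pow_succ, pow_two])).symm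
  have hy2 : y⁻¹ = y * y := (eq_inv_of_mul_eq_one_left (by rw [← hy, pow_succ, pow_two])).symm
  set p := x⁻¹ * y with hp
  set q := y * x⁻¹ with hq
  have hσp : x * p * x⁻¹ = q := by rw [hp, hq]; group
  have hpq : p * q = (x * y * x)⁻¹ := by
    rw [hp, hq, mul_inv_rev, mul_inv_rev, hy2]; group
  have hqp : q * p = (x * y * x)⁻¹ := by
    rw [eq_comm, inv_eq_iff_mul_eq_one, ← hxy, hp, hq]
    calc x * y * x * (y * x⁻¹ * (x⁻¹ * y)) = x * y * x * y * (x⁻¹ * x⁻¹) * y := by group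
      _ = x * y * x * y * x * y := by
        rw [show x⁻¹ * x⁻¹ = x by nth_rewrite 1 [hx2]; group]
      _ = (x * y) ^ 3 := by simp only [pow_succ, pow_zero, one_mul, mul_assoc]
  have hcomm : Commute p q := hpq.trans hqp.symm
  have hσq : x * q * x⁻¹ = q⁻¹ * p⁻¹ := by
    rw [← mul_inv_rev, hpq, hq, inv_inv]
    calc x * (y * x⁻¹) * x⁻¹ = x * y * (x⁻¹ * x⁻¹) := by group
      _ = x * y * x := by rw [show x⁻¹ * x⁻¹ = x by nth_rewrite 1 [hx2]; group]
  by_cases h3 : Nat.Coprime 3 (orderOf p)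
  · left
    obtain ⟨m, hm⟩ := exists_pow_eq_self_of_coprime h3
    rw [isConj_iff]
    -- In additive notation `(1 - σ) * (2 + σ) = 3` on `⟨p, q⟩`, so that `-m • (2 + σ) p` is mapped
    -- to `-3 * m • p = -p` by `1 - σ`.
    refine ⟨((p * p * q) ^ m)⁻¹, ?_⟩
    have h1 : x * (p * p * q) ^ m * x⁻¹ = (q * p⁻¹) ^ m := by
      rw [← conj_pow]
      congr 1
      calc x * (p * p * q) * x⁻¹ = (x * p * x⁻¹) * (x * p * x⁻¹) * (x * q * x⁻¹) := by group
        _ = q * p⁻¹ := by rw [hσp, hσq]; group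
    have hc1 : Commute (p * p * q)⁻¹ (q * p⁻¹) :=
      (((hcomm.mul_left hcomm).mul_left (Commute.refl q)).mul_right
        ((((Commute.refl p).mul_left (Commute.refl p)).mul_left hcomm.symm).inv_right)).inv_left
    have h2 : (p * p * q)⁻¹ * (q * p⁻¹) = (p ^ 3)⁻¹ := by
      rw [(hcomm.mul_left hcomm).eq, mul_inv_rev, mul_assoc, inv_mul_cancel_left, ← mul_inv_rev,
        pow_succ', pow_two]
    calc ((p * p * q) ^ m)⁻¹ * x * ((p * p * q) ^ m)⁻¹⁻¹
        = ((p * p * q)⁻¹) ^ m * (x * (p * p * q) ^ m * x⁻¹) * x := by rw [inv_pow]; group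
      _ = p⁻¹ * x := by
        rw [h1, ← hc1.mul_pow, h2, inv_pow, hm]
      _ = y⁻¹ * (x * x) := by rw [hp]; group
      _ = (x * y)⁻¹ := by rw [← hx2, mul_inv_rev]
  · right
    have h3' : 3 ∣ orderOf p := by
      by_contra hcon
      exact h3 ((Nat.Prime.coprime_iff_not_dvd Nat.prime_three).2 hcon)
    obtain ⟨k, hk⟩ := h3'
    have hkpos : 0 < k := by
      have := orderOf_pos p
      omega
    set a := p ^ k with ha
    set b := q ^ k with hb
    have ha1 : a ≠ 1 := pow_ne_one_of_lt_orderOf hkpos.ne' (by omega)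
    have ha3 : a ^ 3 = 1 := by rw [ha, ← pow_mul, mul_comm, ← hk, pow_orderOf_eq_one]
    have hσa : x * a * x⁻¹ = b := by rw [ha, ← conj_pow, hσp]
    have hb3 : b ^ 3 = 1 := by rw [← hσa, conj_pow, ha3]; group
    have hab : Commute a b := hcomm.pow_pow k k
    have hσb : x * b * x⁻¹ = b⁻¹ * a⁻¹ := by
      rw [hb, ← conj_pow, hσq, (hcomm.symm.inv_inv).mul_pow, inv_pow, inv_pow]
    have hap : Commute a p := (Commute.refl p).pow_left k
    have hbp : Commute b p := hcomm.symm.pow_left k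
    -- Either `a` is fixed by `x`, or `a * b⁻¹` is fixed by `x` and not trivial.
    by_cases heq : a = b
    · refine ⟨a, ha1, ha3, ?_, hap⟩
      have : x * a = a * x := by
        rw [← mul_inv_eq_iff_eq_mul, hσa, heq]
      exact this.symm
    · refine ⟨a * b⁻¹, ?_, ?_, ?_, hap.mul_left hbp.inv_left⟩
      · rwa [Ne, mul_inv_eq_one]
      · rw [hab.inv_right.mul_pow, inv_pow, ha3, hb3]; group
      · have hb2 : b * b = b⁻¹ := eq_inv_of_mul_eq_one_left (by rw [← hb3, pow_succ, pow_two])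
        have : x * (a * b⁻¹) * x⁻¹ = a * b⁻¹ := by
          calc x * (a * b⁻¹) * x⁻¹ = (x * a * x⁻¹) * (x * b * x⁻¹)⁻¹ := by group
            _ = b * (a * b) := by rw [hσa, hσb]; group
            _ = a * (b * b) := by rw [← mul_assoc, ← hab.eq, mul_assoc]
            _ = a * b⁻¹ := by rw [hb2]
        have h4 : x * (a * b⁻¹) = a * b⁻¹ * x := by
          rwa [mul_inv_eq_iff_eq_mul] at this
        exact h4.symm

/-- Under the centralizer condition, a triple of elements of order `3` with product `1` of which one
lies in `T` is contained in `T`, unless two of its members are conjugate. -/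
theorem mem_or_isConj_of_pow_three [Finite G] {H T : Subgroup G}
    (hT : ∀ x ∈ H, x ^ 3 = 1 → x ∈ T) (hTH : T ≤ H)
    (hC : ∀ t ∈ T, t ≠ 1 → Subgroup.centralizer ({t} : Set G) ≤ H) {x y : G} (hxT : x ∈ T)
    (hx1 : x ≠ 1) (hx : x ^ 3 = 1) (hy : y ^ 3 = 1) (hxy : (x * y) ^ 3 = 1) :
    IsConj x (x * y)⁻¹ ∨ y ∈ T := by
  refine (exists_conj_or_commute hx hy hxy).imp_right ?_
  rintro ⟨c, hc1, hc3, hcx, hcp⟩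
  have hcT : c ∈ T :=
    hT c (hC x hxT hx1 (Subgroup.mem_centralizer_singleton_iff.2 hcx.eq)) hc3
  have hp : x⁻¹ * y ∈ H :=
    hC c hcT hc1 (Subgroup.mem_centralizer_singleton_iff.2 hcp.symm.eq)
  refine hT y ?_ hy
  simpa using H.mul_mem (hTH hxT) hp

end

/-! ### Coordinates for the group `3³ : 2²` -/

/-- Coordinates of the elementary abelian normal subgroup of order `27`. -/
abbrev Vec : Type := ZMod 3 × ZMod 3 × ZMod 3

/-- The group `2²`, as the even sign changes of three coordinates: `(s, r)` stands for the sign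
vector `(s, r, s * r)`. -/
abbrev Sgn : Type := (ZMod 3)ˣ × (ZMod 3)ˣ

/-- The action of even sign changes on vectors. -/
def act (s : Sgn) (x : Vec) : Vec := (s.1 * x.1, s.2 * x.2.1, s.1 * s.2 * x.2.2)

theorem act_one (x : Vec) : act 1 x = x := by simp [act]

theorem act_zero (s : Sgn) : act s 0 = 0 := by simp [act]

theorem act_mul (s r : Sgn) (x : Vec) : act (s * r) x = act s (act r x) := by
  simp only [act, Prod.fst_mul, Prod.snd_mul, Units.val_mul, Prod.mk.injEq]
  exact ⟨by ring, by ring, by ring⟩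

/-- The affine permutation `z ↦ s * z + x` of `ZMod 3`. -/
def affinePerm (x : ZMod 3) (s : (ZMod 3)ˣ) : Equiv.Perm (ZMod 3) where
  toFun z := s * z + x
  invFun z := s⁻¹ * (z - x)
  left_inv z := by beta_reduce; rw [add_sub_cancel_right, Units.inv_mul_cancel_left]
  right_inv z := by beta_reduce; rw [Units.mul_inv_cancel_left, sub_add_cancel]

theorem affinePerm_mul (x y : ZMod 3) (s r : (ZMod 3)ˣ) :
    affinePerm x s * affinePerm y r = affinePerm (x + s * y) (s * r) := by
  ext z
  simp only [affinePerm, Equiv.Perm.mul_apply, Equiv.coe_fn_mk, Units.val_mul]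
  ring_nf

theorem affinePerm_injective {x y : ZMod 3} {s r : (ZMod 3)ˣ}
    (h : affinePerm x s = affinePerm y r) : x = y ∧ s = r := by
  have h0 : s * 0 + x = r * 0 + y := DFunLike.congr_fun h 0
  rw [mul_zero, mul_zero, zero_add, zero_add] at h0
  have h1 : s * 1 + x = r * 1 + y := DFunLike.congr_fun h 1
  rw [mul_one, mul_one, h0, add_left_inj] at h1
  exact ⟨h0, Units.ext h1⟩

/-- The nine points as three blocks `{0, 1, 2}`, `{3, 4, 5}`, `{6, 7, 8}`, each labelled by
`ZMod 3`. -/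
def threeBlocks : ZMod 3 ⊕ ZMod 3 ⊕ ZMod 3 ≃ Fin 9 :=
  ((Equiv.refl (Fin 3)).sumCongr (finSumFinEquiv (m := 3) (n := 3))).trans
    (finSumFinEquiv (m := 3) (n := 6))

/-- The permutation of the nine points that is affine on each block, with translation part `x` and
linear part the even sign vector of `s`. -/
def blockPerm (x : Vec) (s : Sgn) : Equiv.Perm (Fin 9) :=
  threeBlocks.permCongr (Equiv.Perm.sumCongr (affinePerm x.1 s.1)
    (Equiv.Perm.sumCongr (affinePerm x.2.1 s.2) (affinePerm x.2.2 (s.1 * s.2))))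

theorem blockPerm_mul (x y : Vec) (s r : Sgn) :
    blockPerm x s * blockPerm y r = blockPerm (x + act s y) (s * r) := by
  rw [blockPerm, blockPerm, ← Equiv.permCongr_mul, Equiv.Perm.sumCongr_mul,
    Equiv.Perm.sumCongr_mul, affinePerm_mul, affinePerm_mul, affinePerm_mul,
    mul_mul_mul_comm s.1 s.2]
  rfl

theorem blockPerm_injective {x y : Vec} {s r : Sgn} (h : blockPerm x s = blockPerm y r) :
    x = y ∧ s = r := by
  have h1 := threeBlocks.permCongr.injective h
  have h2 := Equiv.Perm.sumCongrHom_injective (a₁ := (affinePerm x.1 s.1, _))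
    (a₂ := (affinePerm y.1 r.1, _)) h1
  rw [Prod.mk.injEq] at h2
  have h3 := Equiv.Perm.sumCongrHom_injective (a₁ := (affinePerm x.2.1 s.2, _))
    (a₂ := (affinePerm y.2.1 r.2, _)) h2.2
  rw [Prod.mk.injEq] at h3
  have a1 := affinePerm_injective h2.1
  have a2 := affinePerm_injective h3.1
  have a3 := affinePerm_injective h3.2
  exact ⟨Prod.ext a1.1 (Prod.ext a2.1 a3.1), Prod.ext a1.2 a2.2⟩

theorem blockPerm_zero_one : blockPerm 0 1 = 1 := by decide

theorem generators_eq :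
    (c[0, 1, 2] : Equiv.Perm (Fin 9)) = blockPerm (1, 0, 0) 1 ∧
    (c[3, 4, 5] : Equiv.Perm (Fin 9)) = blockPerm (0, 1, 0) 1 ∧
    (c[6, 7, 8] : Equiv.Perm (Fin 9)) = blockPerm (0, 0, 1) 1 ∧
    (c[0, 1] * c[3, 4] : Equiv.Perm (Fin 9)) = blockPerm (1, 1, 0) (-1, -1) ∧
    (c[0, 1] * c[6, 7] : Equiv.Perm (Fin 9)) = blockPerm (1, 0, 1) (-1, 1) := by
  decide

theorem mem_modelGroup {σ : Equiv.Perm (Fin 9)} :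
    σ ∈ modelGroup ↔ ∃ x s, blockPerm x s = σ := by
  obtain ⟨g1, g2, g3, g4, g5⟩ := generators_eq
  constructor
  · intro h
    induction h using Subgroup.closure_induction with
    | mem y hy =>
      simp only [Set.mem_insert_iff, Set.mem_singleton_iff] at hy
      rcases hy with rfl | rfl | rfl | rfl | rfl
      exacts [⟨_, _, g1.symm⟩, ⟨_, _, g2.symm⟩, ⟨_, _, g3.symm⟩, ⟨_, _, g4.symm⟩, ⟨_, _, g5.symm⟩]
    | one => exact ⟨0, 1, blockPerm_zero_one⟩
    | mul y z _ _ hy hz =>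
      obtain ⟨x, s, rfl⟩ := hy
      obtain ⟨x', s', rfl⟩ := hz
      exact ⟨_, _, (blockPerm_mul _ _ _ _).symm⟩
    | inv y _ hy =>
      obtain ⟨x, s, rfl⟩ := hy
      refine ⟨- act s⁻¹ x, s⁻¹, eq_inv_of_mul_eq_one_left ?_⟩
      rw [blockPerm_mul, neg_add_cancel, inv_mul_cancel, blockPerm_zero_one]
  · rintro ⟨x, s, rfl⟩
    have m1 : blockPerm (1, 0, 0) 1 ∈ modelGroup := g1 ▸ Subgroup.subset_closure (by simp)
    have m2 : blockPerm (0, 1, 0) 1 ∈ modelGroup := g2 ▸ Subgroup.subset_closure (by simp)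
    have m3 : blockPerm (0, 0, 1) 1 ∈ modelGroup := g3 ▸ Subgroup.subset_closure (by simp)
    have m4 : blockPerm (1, 1, 0) (-1, -1) ∈ modelGroup := g4 ▸ Subgroup.subset_closure (by simp)
    have m5 : blockPerm (1, 0, 1) (-1, 1) ∈ modelGroup := g5 ▸ Subgroup.subset_closure (by simp)
    have hadd : ∀ x y, blockPerm x 1 ∈ modelGroup → blockPerm y 1 ∈ modelGroup →
        blockPerm (x + y) 1 ∈ modelGroup := by
      intro x y hx hy
      have := modelGroup.mul_mem hx hy
      rwa [blockPerm_mul, act_one, mul_one] at this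
    have hsmul : ∀ x, blockPerm x 1 ∈ modelGroup → ∀ n : ℕ, blockPerm (n • x) 1 ∈ modelGroup := by
      intro x hx n
      induction n with
      | zero => rw [zero_smul, blockPerm_zero_one]; exact one_mem _
      | succ n ih => rw [succ_nsmul]; exact hadd _ _ ih hx
    have hx : ∀ x, blockPerm x 1 ∈ modelGroup := by
      intro x
      have : x = x.1.val • ((1, 0, 0) : Vec) + x.2.1.val • ((0, 1, 0) : Vec) +
          x.2.2.val • ((0, 0, 1) : Vec) := by
        revert x; decide
      rw [this]
      exact hadd _ _ (hadd _ _ (hsmul _ m1 _) (hsmul _ m2 _)) (hsmul _ m3 _)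
    have hs : ∃ y, blockPerm y s ∈ modelGroup := by
      -- The linear parts of the last two generators generate the group of signs.
      have : ∀ s : Sgn, s = 1 ∨ s = (-1, -1) ∨ s = (-1, 1) ∨ s = (-1, -1) * (-1, 1) := by decide
      rcases this s with rfl | rfl | rfl | rfl
      · exact ⟨0, hx 0⟩
      · exact ⟨_, m4⟩
      · exact ⟨_, m5⟩
      · exact ⟨_, blockPerm_mul _ _ _ _ ▸ modelGroup.mul_mem m4 m5⟩
    obtain ⟨y, hy⟩ := hs
    have := modelGroup.mul_mem (hx (x - y)) hy
    rwa [blockPerm_mul, act_one, sub_add_cancel, one_mul] at this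

/-- A parametrization of `H` as the semidirect product of `Vec` with `Sgn`, in which `T` corresponds
to the normal subgroup `Vec`. -/
structure Coordinates {G : Type*} [Group G] (H T : Subgroup G) where
  toFun : Vec → Sgn → G
  map_mul : ∀ x y s r, toFun x s * toFun y r = toFun (x + act s y) (s * r)
  inj : ∀ x y s r, toFun x s = toFun y r → x = y ∧ s = r
  mem_left_iff : ∀ g, g ∈ H ↔ ∃ x s, toFun x s = g
  mem_right_iff : ∀ g, g ∈ T ↔ ∃ x, toFun x 1 = g

theorem exists_coordinates {G : Type*} [Group G] [Finite G] (H : Subgroup G)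
    (hH : Nonempty (↥H ≃* ↥modelGroup)) (T : Sylow 3 ↥H) :
    Nonempty (Coordinates H ((T : Subgroup ↥H).map H.subtype)) := by
  obtain ⟨φ⟩ := hH
  let P : Vec → Sgn → H := fun x s => φ.symm ⟨blockPerm x s, mem_modelGroup.2 ⟨x, s, rfl⟩⟩
  have hmul : ∀ x y s r, P x s * P y r = P (x + act s y) (s * r) := by
    intro x y s r
    simp only [P, ← map_mul]
    congr 1
    exact Subtype.ext (blockPerm_mul x y s r)
  have hinj : ∀ x y s r, P x s = P y r → x = y ∧ s = r := by
    intro x y s r h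
    exact blockPerm_injective (congrArg Subtype.val (φ.symm.injective h))
  have hsurj : ∀ h : H, ∃ x s, P x s = h := by
    intro h
    obtain ⟨x, s, hxs⟩ := mem_modelGroup.1 (φ h).2
    exact ⟨x, s, by rw [MulEquiv.symm_apply_eq]; exact Subtype.ext hxs⟩
  have hcard : Nat.card H = 108 := by
    rw [← Nat.card_congr (Equiv.ofBijective (fun z : Vec × Sgn => P z.1 z.2)
      ⟨fun a b h => Prod.ext (hinj _ _ _ _ h).1 (hinj _ _ _ _ h).2, fun h => by
        obtain ⟨x, s, hxs⟩ := hsurj h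
        exact ⟨(x, s), hxs⟩⟩), Nat.card_eq_fintype_card]
    rfl
  have hone : P 0 1 = 1 := by
    have := hmul 0 0 1 1
    rwa [act_zero, add_zero, mul_one, mul_eq_left] at this
  have hpow : ∀ x s n, ∃ y, P x s ^ n = P y (s ^ n) := by
    intro x s n
    induction n with
    | zero => exact ⟨0, by rw [pow_zero, pow_zero, hone]⟩
    | succ n ih =>
      obtain ⟨y, hy⟩ := ih
      exact ⟨_, by rw [pow_succ, hy, hmul, ← pow_succ]⟩
  -- Elements of `3`-power order have trivial sign part, as the signs have exponent `2`.
  have hsub : ((T : Subgroup H) : Set H) ⊆ Set.range fun x => P x 1 := by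
    intro t ht
    obtain ⟨x, s, rfl⟩ := hsurj t
    obtain ⟨k, hk⟩ := T.isPGroup' ⟨P x s, ht⟩
    have hk' : P x s ^ 3 ^ k = 1 := congrArg Subtype.val hk
    obtain ⟨y, hy⟩ := hpow x s (3 ^ k)
    rw [hy, ← hone] at hk'
    have h2 : ∀ r : Sgn, r ^ 2 = 1 := by decide
    have hs : s = 1 := by
      obtain ⟨j, hj⟩ : Odd (3 ^ k) := Odd.pow (by decide)
      have := (hinj _ _ _ _ hk').2
      rwa [hj, pow_succ, pow_mul, h2, one_pow, one_mul] at this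
    exact ⟨x, by rw [hs]⟩
  have hrange : ((T : Subgroup H) : Set H) = Set.range fun x => P x 1 := by
    have : Fact (Nat.Prime 3) := ⟨Nat.prime_three⟩
    refine Set.eq_of_subset_of_ncard_le hsub ?_
    have h1 : ((T : Subgroup H) : Set H).ncard = 27 := by
      rw [← Nat.card_coe_set_eq]
      refine (T.card_eq_multiplicity).trans ?_
      rw [hcard]
      have : (108 : ℕ).factorization 3 = 3 := by
        rw [show 108 = 3 ^ 3 * 4 by norm_num, Nat.factorization_mul (by norm_num) (by norm_num),
          Nat.Prime.factorization_pow Nat.prime_three]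
        simp [Nat.factorization_eq_zero_of_not_dvd]
      rw [this]; norm_num
    rw [h1, ← Set.image_univ, Set.ncard_image_of_injective _ fun a b h => (hinj _ _ _ _ h).1,
      Set.ncard_univ, Nat.card_eq_fintype_card]
    exact le_of_eq rfl
  refine ⟨⟨fun x s => P x s, fun x y s r => ?_, fun x y s r h => hinj _ _ _ _ (Subtype.ext h),
    fun g => ⟨fun hg => ?_, ?_⟩, fun g => ⟨?_, ?_⟩⟩⟩
  · rw [← hmul]; rfl
  · obtain ⟨x, s, h⟩ := hsurj ⟨g, hg⟩
    exact ⟨x, s, congrArg Subtype.val h⟩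
  · rintro ⟨x, s, rfl⟩
    exact (P x s).2
  · rintro ⟨t, ht, rfl⟩
    rw [hrange] at ht
    obtain ⟨x, rfl⟩ := ht
    exact ⟨x, rfl⟩
  · rintro ⟨x, rfl⟩
    exact ⟨P x 1, by rw [hrange]; exact ⟨x, rfl⟩, rfl⟩

/-! ### Character sums over `ZMod 3` and its cube -/

noncomputable section

/-- The standard nontrivial additive character of `ZMod 3`. -/
abbrev psi : AddChar (ZMod 3) ℂ := ZMod.stdAddChar

theorem psi_sum : 1 + psi 1 + psi 2 = 0 := by
  have h : (psi : AddChar (ZMod 3) ℂ) ≠ 0 := by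
    have := ZMod.isPrimitive_stdAddChar 3 (one_ne_zero)
    intro h0
    apply this
    ext z
    simp [h0]
  have h1 := AddChar.sum_eq_zero_of_ne_one (ψ := psi) h
  have h2 : ∑ a, psi a = psi 0 + psi 1 + psi 2 := Fin.sum_univ_three _
  rw [← h1, h2, AddChar.map_zero_eq_one]

theorem psi_two : psi 2 = psi 1 ^ 2 := by
  rw [← AddChar.map_nsmul_eq_pow]; rfl

/-- The difference of the two nontrivial characters of `ZMod 3`: a multiple of the sine. -/
def sinHat (z : ZMod 3) : ℂ := psi z - psi (-z)

/-- The sum of the two nontrivial characters of `ZMod 3`: twice the cosine. -/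
def cosHat (z : ZMod 3) : ℂ := psi z + psi (-z)

theorem sinHat_eq_zero_or (z : ZMod 3) : sinHat z = 0 ∨ cosHat z = -1 := by
  have h : z = 0 ∨ z = 1 ∨ z = 2 := by revert z; decide
  have h1 := psi_sum
  rcases h with rfl | rfl | rfl
  · left; simp [sinHat]
  · right
    rw [cosHat, show (-1 : ZMod 3) = 2 from rfl]
    linear_combination h1
  · right
    rw [cosHat, show (-2 : ZMod 3) = 1 from rfl]
    linear_combination h1

theorem sum_zmod_three (f : ZMod 3 → ℂ) : ∑ z, f z = f 0 + f 1 + f 2 := Fin.sum_univ_three f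

theorem sum_psi_mul_sinHat_neg : ∑ z, psi z * sinHat (-z) = 3 := by
  have h := psi_sum
  rw [sum_zmod_three]
  simp only [sinHat, show (-0 : ZMod 3) = 0 from rfl, show (-1 : ZMod 3) = 2 from rfl,
    show (-2 : ZMod 3) = 1 from rfl, psi_two, AddChar.map_zero_eq_one] at h ⊢
  linear_combination (3 * psi 1 - 3 - psi 1 ^ 2) * h

theorem sum_psi_mul_sinHat : ∑ z, ∑ w, psi z * sinHat w = 0 := by
  simp only [sum_zmod_three]
  simp only [sinHat, show (-0 : ZMod 3) = 0 from rfl, show (-1 : ZMod 3) = 2 from rfl,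
    show (-2 : ZMod 3) = 1 from rfl]
  ring

theorem sum_psi_mul_sinHat_mul_cosHat :
    ∑ z, ∑ w, psi z * sinHat w * cosHat (-w - z) = 9 := by
  have h := psi_sum
  simp only [sum_zmod_three]
  simp only [sinHat, cosHat, show (-0 : ZMod 3) = 0 from rfl, show (-1 : ZMod 3) = 2 from rfl,
    show (-2 : ZMod 3) = 1 from rfl, show (2 - 1 : ZMod 3) = 1 from rfl,
    show (2 - 2 : ZMod 3) = 0 from rfl,
    show (1 - 1 : ZMod 3) = 0 from rfl, show (1 - 2 : ZMod 3) = 2 from rfl,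
    show (0 - 1 : ZMod 3) = 2 from rfl, show (0 - 2 : ZMod 3) = 1 from rfl, sub_zero,
    AddChar.map_zero_eq_one, psi_two] at h ⊢
  linear_combination (psi 1 ^ 4 - 2 * psi 1 ^ 3 - 2 * psi 1 ^ 2 + 9 * psi 1 - 9) * h

theorem sum_vec (f g h : ZMod 3 → ℂ) :
    ∑ x : Vec, f x.1 * g x.2.1 * h x.2.2 = (∑ z, f z) * (∑ z, g z) * ∑ z, h z := by
  simp only [Fintype.sum_prod_type, mul_assoc, ← Finset.mul_sum, ← Finset.sum_mul]

theorem sum_vec_vec (f g h : ZMod 3 → ZMod 3 → ℂ) :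
    ∑ x : Vec, ∑ y : Vec, f x.1 y.1 * g x.2.1 y.2.1 * h x.2.2 y.2.2 =
      (∑ z, ∑ w, f z w) * (∑ z, ∑ w, g z w) * ∑ z, ∑ w, h z w := by
  simp only [sum_vec, ← sum_vec (fun z => ∑ w, f z w) (fun z => ∑ w, g z w) (fun z => ∑ w, h z w)]

theorem sum_sgn (f : Sgn → ℂ) :
    ∑ s, f s = f (1, 1) + f (1, -1) + f (-1, 1) + f (-1, -1) := by
  have h : ∀ g : (ZMod 3)ˣ → ℂ, ∑ u, g u = g 1 + g (-1) := by
    intro g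
    rw [show (Finset.univ : Finset (ZMod 3)ˣ) = {1, -1} by decide,
      Finset.sum_pair (by decide)]
  rw [Fintype.sum_prod_type, h, h, h]
  ring



theorem sinHat_neg (z : ZMod 3) : sinHat (-z) = -sinHat z := by simp [sinHat]

theorem cosHat_neg (z : ZMod 3) : cosHat (-z) = cosHat z := by simp [cosHat, add_comm]

theorem sum_psi_neg_mul_sinHat_neg : ∑ z, psi (-z) * sinHat (-z) = -3 := by
  rw [← sum_psi_mul_sinHat_neg, ← Equiv.sum_comp (Equiv.neg (ZMod 3)), ← Finset.sum_neg_distrib]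
  simp [sinHat_neg]

theorem sum_psi_neg_mul_sinHat : ∑ z, ∑ w, psi (-z) * sinHat w = 0 := by
  rw [← Equiv.sum_comp (Equiv.neg (ZMod 3)), ← sum_psi_mul_sinHat]
  simp

theorem sum_psi_neg_mul_sinHat_mul_cosHat :
    ∑ z, ∑ w, psi (-z) * sinHat w * cosHat (-w - z) = -9 := by
  rw [← Equiv.sum_comp (Equiv.neg (ZMod 3)), ← sum_psi_mul_sinHat_mul_cosHat,
    ← Finset.sum_neg_distrib]
  refine Finset.sum_congr rfl fun z _ => ?_
  rw [← Equiv.sum_comp (Equiv.neg (ZMod 3)), ← Finset.sum_neg_distrib]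
  refine Finset.sum_congr rfl fun w _ => ?_
  simp only [Equiv.neg_apply]
  rw [show - -w - -z = -(-w - z) by ring, neg_neg, sinHat_neg, cosHat_neg]
  ring

/-- The linear character of `Vec` with frequency vector `k`. -/
def lam (k : Vec) : AddChar Vec ℂ where
  toFun x := psi (k.1 * x.1 + k.2.1 * x.2.1 + k.2.2 * x.2.2)
  map_zero_eq_one' := by simp
  map_add_eq_mul' x y := by
    rw [← AddChar.map_add_eq_mul]
    congr 1
    simp only [Prod.fst_add, Prod.snd_add]
    ring

theorem lam_apply (k x : Vec) :
    lam k x = psi (k.1 * x.1) * psi (k.2.1 * x.2.1) * psi (k.2.2 * x.2.2) := by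
  rw [← AddChar.map_add_eq_mul, ← AddChar.map_add_eq_mul]; rfl

/-- The function on `Vec` behind the first class function: the coefficients of the idempotent of
the character `(1, 1, 1)`, which is not real under `H`, minus those of its complex conjugate. The
sum over sign changes is the product of three sines. -/
def alphaSeed (x : Vec) : ℂ := lam (1, 1, 1) x / 27 - lam (-1, -1, -1) x / 27

/-- The function on `Vec` behind the second class function. The coefficients are such that the sum
over sign changes vanishes at `0` and at all vectors without zero coordinate, where that of
`alphaSeed` does not vanish, and such that both characters of `alphaSeed` have the same positive
coefficient. -/
def gammaSeed (x : Vec) : ℂ :=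
  lam (0, 0, 0) x / 27 - 3 * (lam (1, 1, 0) x / 27) + lam (1, 1, 1) x / 27 +
    lam (-1, -1, -1) x / 27

/-- The sum of a function over the images of a vector under even sign changes. For a linear
character of `Vec`, these are the values on `Vec` of the character induced to `H`. -/
def orbitSum (f : Vec → ℂ) (x : Vec) : ℂ := ∑ s : Sgn, f (act s x)

theorem alphaSeed_apply (x : Vec) : alphaSeed x =
    (psi x.1 * psi x.2.1 * psi x.2.2 - psi (-x.1) * psi (-x.2.1) * psi (-x.2.2)) / 27 := by
  simp [alphaSeed, lam_apply, sub_div]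

theorem alphaSeed_zero : alphaSeed 0 = 0 := by simp [alphaSeed]

theorem gammaSeed_zero : gammaSeed 0 = 0 := by simp [gammaSeed]; norm_num

theorem orbitSum_alphaSeed (x : Vec) :
    orbitSum alphaSeed x = sinHat x.1 * sinHat x.2.1 * sinHat x.2.2 / 27 := by
  simp only [orbitSum, sum_sgn, alphaSeed_apply, act, sinHat, Units.val_neg, Units.val_one,
    neg_mul, one_mul, neg_neg, mul_neg]
  ring

theorem orbitSum_gammaSeed (x : Vec) :
    orbitSum gammaSeed x =
      (4 - 3 * (cosHat x.1 * cosHat x.2.1) + cosHat x.1 * cosHat x.2.1 * cosHat x.2.2) / 27 := by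
  simp only [orbitSum, sum_sgn, gammaSeed, lam_apply, act, cosHat, Units.val_neg, Units.val_one,
    neg_mul, one_mul, neg_neg, mul_neg, zero_mul, AddChar.map_zero_eq_one]
  ring

theorem orbitSum_mul_orbitSum (x : Vec) :
    orbitSum alphaSeed x * orbitSum gammaSeed x = 0 := by
  rw [orbitSum_alphaSeed, orbitSum_gammaSeed]
  rcases sinHat_eq_zero_or x.1 with h1 | h1
  · simp [h1]
  rcases sinHat_eq_zero_or x.2.1 with h2 | h2
  · simp [h2]
  rcases sinHat_eq_zero_or x.2.2 with h3 | h3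
  · simp [h3]
  rw [h1, h2, h3]
  norm_num

/-- The class function from `alphaSeed` has norm `2`. -/
theorem sum_alphaSeed_mul_orbitSum :
    ∑ x, alphaSeed x * (27 * orbitSum alphaSeed (-x)) = 2 := by
  have h : ∀ x, alphaSeed x * (27 * orbitSum alphaSeed (-x)) =
      ((psi x.1 * sinHat (-x.1)) * (psi x.2.1 * sinHat (-x.2.1)) * (psi x.2.2 * sinHat (-x.2.2)) -
      (psi (-x.1) * sinHat (-x.1)) * (psi (-x.2.1) * sinHat (-x.2.1)) *
        (psi (-x.2.2) * sinHat (-x.2.2))) / 27 := by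
    intro x
    rw [alphaSeed_apply, orbitSum_alphaSeed]
    simp only [Prod.fst_neg, Prod.snd_neg]
    ring
  simp only [h, ← Finset.sum_div, Finset.sum_sub_distrib]
  rw [sum_vec (fun z => psi z * sinHat (-z)) (fun z => psi z * sinHat (-z))
      (fun z => psi z * sinHat (-z)),
    sum_vec (fun z => psi (-z) * sinHat (-z)) (fun z => psi (-z) * sinHat (-z))
      (fun z => psi (-z) * sinHat (-z)),
    sum_psi_mul_sinHat_neg, sum_psi_neg_mul_sinHat_neg]
  norm_num

theorem sum_alphaSeed_mul_orbitSum_mul_orbitSum :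
    ∑ x, ∑ y, alphaSeed x * ((27 * orbitSum alphaSeed y) * (27 * orbitSum gammaSeed (-y - x))) =
      54 := by
  let A (z w : ZMod 3) : ℂ := psi z * sinHat w
  let A' (z w : ZMod 3) : ℂ := psi (-z) * sinHat w
  let B (z w : ZMod 3) : ℂ := psi z * sinHat w * cosHat (-w - z)
  let B' (z w : ZMod 3) : ℂ := psi (-z) * sinHat w * cosHat (-w - z)
  have h : ∀ x y : Vec,
      alphaSeed x * ((27 * orbitSum alphaSeed y) * (27 * orbitSum gammaSeed (-y - x))) =
      (4 * (A x.1 y.1 * A x.2.1 y.2.1 * A x.2.2 y.2.2)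
      - 4 * (A' x.1 y.1 * A' x.2.1 y.2.1 * A' x.2.2 y.2.2)
      - 3 * (B x.1 y.1 * B x.2.1 y.2.1 * A x.2.2 y.2.2)
      + 3 * (B' x.1 y.1 * B' x.2.1 y.2.1 * A' x.2.2 y.2.2)
      + B x.1 y.1 * B x.2.1 y.2.1 * B x.2.2 y.2.2
      - B' x.1 y.1 * B' x.2.1 y.2.1 * B' x.2.2 y.2.2) / 27 := by
    intro x y
    rw [alphaSeed_apply, orbitSum_alphaSeed, orbitSum_gammaSeed]
    simp only [Prod.fst_neg, Prod.snd_neg, Prod.fst_sub, Prod.snd_sub, A, A', B, B']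
    ring
  simp only [h, ← Finset.sum_div, Finset.sum_sub_distrib, Finset.sum_add_distrib,
    ← Finset.mul_sum]
  simp only [sum_vec_vec]
  simp only [A, A', B, B']
  rw [sum_psi_mul_sinHat, sum_psi_neg_mul_sinHat, sum_psi_mul_sinHat_mul_cosHat,
    sum_psi_neg_mul_sinHat_mul_cosHat]
  norm_num

end

/-! ### Class functions induced from the trivial intersection subgroup -/

noncomputable section

namespace Coordinates

variable {G : Type*} [Group G] {H T : Subgroup G} (C : Coordinates H T)

theorem map_zero : C.toFun 0 1 = 1 := by
  have := C.map_mul 0 0 1 1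
  rwa [act_zero, add_zero, mul_one, mul_eq_left] at this

theorem map_add (x y : Vec) : C.toFun (x + y) 1 = C.toFun x 1 * C.toFun y 1 := by
  rw [C.map_mul, act_one, mul_one]

theorem map_neg (x : Vec) : C.toFun (-x) 1 = (C.toFun x 1)⁻¹ := by
  rw [eq_inv_iff_mul_eq_one, ← C.map_add, neg_add_cancel, C.map_zero]

theorem injective : Function.Injective fun x => C.toFun x 1 := fun _ _ h => (C.inj _ _ _ _ h).1

theorem map_ne_one {x : Vec} (hx : x ≠ 0) : C.toFun x 1 ≠ 1 := by
  rw [← C.map_zero]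
  exact fun h => hx (C.injective h)

theorem pow_three (x : Vec) : C.toFun x 1 ^ 3 = 1 := by
  have : x + x + x = 0 := by revert x; decide
  rw [pow_succ, pow_two, ← C.map_add, ← C.map_add, this, C.map_zero]

theorem le (C : Coordinates H T) : T ≤ H := fun g hg => by
  obtain ⟨x, rfl⟩ := (C.mem_right_iff g).1 hg
  exact (C.mem_left_iff _).2 ⟨x, 1, rfl⟩

theorem mem_of_pow_three (C : Coordinates H T) {g : G} (hg : g ∈ H) (h : g ^ 3 = 1) : g ∈ T := by
  obtain ⟨x, s, rfl⟩ := (C.mem_left_iff g).1 hg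
  rw [pow_succ, pow_two, C.map_mul, C.map_mul, ← C.map_zero] at h
  have h1 : ∀ s : Sgn, s * s * s = 1 → s = 1 := by decide
  rw [h1 s (C.inj _ _ _ _ h).2]
  exact (C.mem_right_iff _).2 ⟨x, rfl⟩

theorem conj_map (x y : Vec) (s : Sgn) :
    (C.toFun x s)⁻¹ * C.toFun y 1 * C.toFun x s = C.toFun (act s⁻¹ y) 1 := by
  rw [mul_assoc, inv_mul_eq_iff_eq_mul, C.map_mul, C.map_mul, ← act_mul, act_one, mul_inv_cancel,
    act_one, one_mul, mul_one, add_comm]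

/-- The parametrization of `H` as a bijection. -/
def equiv : Vec × Sgn ≃ H :=
  Equiv.ofBijective (fun z => ⟨C.toFun z.1 z.2, (C.mem_left_iff _).2 ⟨_, _, rfl⟩⟩)
    ⟨fun _ _ h => by
      have := C.inj _ _ _ _ (congrArg Subtype.val h)
      exact Prod.ext this.1 this.2, fun h => by
      obtain ⟨x, s, hxs⟩ := (C.mem_left_iff h).1 h.2
      exact ⟨(x, s), Subtype.ext hxs⟩⟩

theorem card_eq (C : Coordinates H T) : Nat.card H = 108 := by
  rw [← Nat.card_congr C.equiv, Nat.card_eq_fintype_card]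
  rfl

/-- The element of `ℂ[G]` supported on `T` whose coefficients are the values of `f`. -/
def embed (f : Vec → ℂ) : MonoidAlgebra ℂ G := ∑ x, MonoidAlgebra.single (C.toFun x 1) (f x)

theorem coeff_embed (f : Vec → ℂ) (x : Vec) : (C.embed f).coeff (C.toFun x 1) = f x := by
  simp only [embed, MonoidAlgebra.coeff_sum, Finsupp.finsetSum_apply, MonoidAlgebra.coeff_single]
  rw [Finset.sum_eq_single x, Finsupp.single_eq_same]
  · intro y _ hy
    exact Finsupp.single_eq_of_ne fun h => hy (C.injective h.symm)
  · simp

theorem coeff_embed_eq_zero (f : Vec → ℂ) {g : G} (hg : g ∉ T) : (C.embed f).coeff g = 0 := by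
  simp only [embed, MonoidAlgebra.coeff_sum, Finsupp.finsetSum_apply, MonoidAlgebra.coeff_single]
  refine Finset.sum_eq_zero fun x _ => Finsupp.single_eq_of_ne ?_
  rintro rfl
  exact hg ((C.mem_right_iff _).2 ⟨x, rfl⟩)

theorem coeff_embed_mul (f : Vec → ℂ) (b : MonoidAlgebra ℂ G) :
    (C.embed f * b).coeff 1 = ∑ x, f x * b.coeff (C.toFun (-x) 1) := by
  simp [embed, Finset.sum_mul, MonoidAlgebra.coeff_sum, Finsupp.finsetSum_apply, C.map_neg]

theorem isIdempotentElem_embed (k : Vec) : IsIdempotentElem (C.embed fun x => lam k x / 27) := by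
  have h : ∀ x y, MonoidAlgebra.single (C.toFun x 1) (lam k x / 27) *
      MonoidAlgebra.single (C.toFun y 1) (lam k y / 27) =
      MonoidAlgebra.single (C.toFun (x + y) 1) (lam k (x + y) / 27 / 27) := by
    intro x y
    rw [MonoidAlgebra.single_mul_single, C.map_add, AddChar.map_add_eq_mul]
    congr 1
    ring
  rw [IsIdempotentElem, embed, Finset.sum_mul_sum]
  simp only [h]
  have h2 : ∀ x, ∑ y, MonoidAlgebra.single (C.toFun (x + y) 1) (lam k (x + y) / 27 / 27) =
      ∑ y, MonoidAlgebra.single (C.toFun y 1) (lam k y / 27 / 27) := fun x =>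
    Equiv.sum_comp (Equiv.addLeft x)
      fun y => MonoidAlgebra.single (C.toFun y 1) (lam k y / 27 / 27)
  simp only [h2, Finset.sum_const, Finset.smul_sum]
  refine Finset.sum_congr rfl fun y _ => ?_
  rw [MonoidAlgebra.smul_single, Finset.card_univ, show Fintype.card Vec = 27 from rfl]
  congr 1
  rw [nsmul_eq_mul]
  push_cast
  ring

theorem embed_add (f g : Vec → ℂ) : C.embed (f + g) = C.embed f + C.embed g := by
  simp [embed, MonoidAlgebra.single_add, Finset.sum_add_distrib]

theorem embed_neg (f : Vec → ℂ) : C.embed (-f) = - C.embed f := by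
  simp [embed, MonoidAlgebra.single_neg, Finset.sum_neg_distrib]

theorem embed_mem {f : Vec → ℂ} (hf : f ∈ AddSubgroup.closure (Set.range fun k x => lam k x / 27)) :
    C.embed f ∈ AddSubgroup.closure {e : MonoidAlgebra ℂ G | IsIdempotentElem e} := by
  induction hf using AddSubgroup.closure_induction with
  | mem f hf =>
    obtain ⟨k, rfl⟩ := hf
    exact AddSubgroup.subset_closure (C.isIdempotentElem_embed k)
  | zero => simp [embed]
  | add f g _ _ hf hg => exact C.embed_add f g ▸ add_mem hf hg
  | neg f _ hf => exact C.embed_neg f ▸ neg_mem hf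

end Coordinates

theorem lam_mem (k : Vec) :
    (fun x => lam k x / 27) ∈ AddSubgroup.closure (Set.range fun k x => lam k x / 27) :=
  AddSubgroup.subset_closure ⟨k, rfl⟩

theorem alphaSeed_mem :
    alphaSeed ∈ AddSubgroup.closure (Set.range fun k x => lam k x / 27) :=
  sub_mem (lam_mem _) (lam_mem _)

theorem gammaSeed_mem :
    gammaSeed ∈ AddSubgroup.closure (Set.range fun k x => lam k x / 27) := by
  have h := add_mem (add_mem (sub_mem (lam_mem (0, 0, 0)) (nsmul_mem (lam_mem (1, 1, 0)) 3))
    (lam_mem (1, 1, 1))) (lam_mem (-1, -1, -1))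
  convert h using 1
  ext x
  simp [gammaSeed]

section

variable {G : Type*} [Group G] {H T : Subgroup G}

/-- `T` is a trivial intersection subgroup with normalizer `H`: if `g⁻¹ * t * g` lies in `T` as
well, then the abelian group `g⁻¹ * T * g` centralizes it, so is contained in `H` and hence in `T`. -/
theorem mem_of_conj_mem [Finite G] (C : Coordinates H T)
    (hN : Subgroup.normalizer (T : Set G) = H)
    (hC : ∀ t ∈ T, t ≠ 1 → Subgroup.centralizer ({t} : Set G) ≤ H) {t g : G} (ht : t ∈ T)
    (ht1 : t ≠ 1) (htg : g⁻¹ * t * g ∈ T) : g ∈ H := by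
  have hsub : ∀ u ∈ T, g⁻¹ * u * g ∈ T := by
    intro u hu
    have hcomm : Commute u t := by
      obtain ⟨x, rfl⟩ := (C.mem_right_iff _).1 hu
      obtain ⟨y, rfl⟩ := (C.mem_right_iff _).1 ht
      change _ * _ = _ * _
      rw [← C.map_add, ← C.map_add, add_comm]
    have hu3 : u ^ 3 = 1 := by
      obtain ⟨x, rfl⟩ := (C.mem_right_iff _).1 hu
      exact C.pow_three x
    refine C.mem_of_pow_three (hC _ htg ?_ (Subgroup.mem_centralizer_singleton_iff.2 ?_)) ?_
    · intro h
      apply ht1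
      rw [mul_assoc, inv_mul_eq_one] at h
      simpa using h.symm
    · calc g⁻¹ * u * g * (g⁻¹ * t * g) = g⁻¹ * (u * t) * g := by group
        _ = g⁻¹ * t * g * (g⁻¹ * u * g) := by rw [hcomm.eq]; group
    · have := conj_pow (i := 3) (a := g⁻¹) (b := u)
      rw [inv_inv] at this
      rw [this, hu3]; group
  rw [← hN, ← inv_mem_iff]
  exact Subgroup.mem_normalizer_fintype fun u hu => by rw [inv_inv]; exact hsub u hu

/-- If `g ∉ H`, then the elements of `g⁻¹ * T * g` other than `1` are not in `H`, so that the double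
coset `T * g * H` has `27 * 108` elements. -/
theorem le_card_of_notMem [Finite G] (C : Coordinates H T)
    (hN : Subgroup.normalizer (T : Set G) = H)
    (hC : ∀ t ∈ T, t ≠ 1 → Subgroup.centralizer ({t} : Set G) ≤ H) {g : G} (hg : g ∉ H) :
    2916 ≤ Nat.card G := by
  have hinj : Function.Injective fun z : Vec × H => C.toFun z.1 1 * g * z.2 := by
    rintro ⟨x, h⟩ ⟨x', h'⟩ heq
    have h1 : g⁻¹ * C.toFun (-x' + x) 1 * g = h' * (h : G)⁻¹ := by
      rw [C.map_add, C.map_neg, eq_mul_inv_iff_mul_eq]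
      have heq' : C.toFun x 1 * g * h = C.toFun x' 1 * g * h' := heq
      calc g⁻¹ * ((C.toFun x' 1)⁻¹ * C.toFun x 1) * g * h
          = g⁻¹ * (C.toFun x' 1)⁻¹ * (C.toFun x 1 * g * h) := by group
        _ = h' := by rw [heq']; group
    have hx : -x' + x = 0 := by
      by_contra hne
      refine hg (mem_of_conj_mem C hN hC ((C.mem_right_iff _).2 ⟨_, rfl⟩) (C.map_ne_one hne) ?_)
      refine C.mem_of_pow_three (h1 ▸ (h' * h⁻¹).2) ?_
      have := conj_pow (i := 3) (a := g⁻¹) (b := C.toFun (-x' + x) 1)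
      rw [inv_inv] at this
      rw [this, C.pow_three]; group
    have hx' : x = x' := by rw [neg_add_eq_zero] at hx; exact hx.symm
    subst hx'
    exact Prod.ext rfl (Subtype.ext (mul_left_cancel heq))
  have := Nat.card_le_card_of_injective _ hinj
  rw [Nat.card_prod, C.card_eq, Nat.card_eq_fintype_card] at this
  exact le_trans (le_of_eq rfl) this

theorem coeff_conjSum_of_isConj [Fintype G] (a : MonoidAlgebra ℂ G) {x y : G} (h : IsConj x y) :
    (conjSum a).coeff x = (conjSum a).coeff y := by
  obtain ⟨c, rfl⟩ := isConj_iff.1 h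
  rw [coeff_conjSum, coeff_conjSum,
    ← Equiv.sum_comp (Equiv.mulLeft c) fun g => a.coeff (g⁻¹ * (c * x * c⁻¹) * g)]
  refine Finset.sum_congr rfl fun g _ => ?_
  congr 1
  rw [Equiv.coe_mulLeft]
  group

theorem coeff_mul_eq_sum [Fintype G] (a b : MonoidAlgebra ℂ G) (z : G) :
    (a * b).coeff z = ∑ g, a.coeff g * b.coeff (g⁻¹ * z) := by
  rw [MonoidAlgebra.coeff_mul_apply_left, Finsupp.sum_fintype]
  simp

theorem pow_three_of_coeff_conjSum_ne_zero [Fintype G] (C : Coordinates H T) {f : Vec → ℂ} {z : G}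
    (h : (conjSum (C.embed f)).coeff z ≠ 0) : z ^ 3 = 1 := by
  rw [coeff_conjSum] at h
  obtain ⟨g, -, hg⟩ := Finset.exists_ne_zero_of_sum_ne_zero h
  have hT : g⁻¹ * z * g ∈ T := by
    by_contra hcon
    exact hg (C.coeff_embed_eq_zero f hcon)
  obtain ⟨x, hx⟩ := (C.mem_right_iff _).1 hT
  have h3 := C.pow_three x
  have := conj_pow (i := 3) (a := g⁻¹) (b := z)
  rw [inv_inv] at this
  rw [hx, this] at h3
  calc z ^ 3 = g * (g⁻¹ * z ^ 3 * g) * g⁻¹ := by group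
    _ = 1 := by rw [h3]; group

/-- The values on `T` of a class function induced from `T` depend on `H` only, since `T` is a
trivial intersection subgroup with normalizer `H`. -/
theorem coeff_conjSum_embed [Fintype G] (C : Coordinates H T)
    (hN : Subgroup.normalizer (T : Set G) = H)
    (hC : ∀ t ∈ T, t ≠ 1 → Subgroup.centralizer ({t} : Set G) ≤ H) {f : Vec → ℂ} (hf : f 0 = 0)
    (y : Vec) : (conjSum (C.embed f)).coeff (C.toFun y 1) = 27 * orbitSum f y := by
  rw [coeff_conjSum]
  by_cases hy : y = 0
  · subst hy
    have h0 : (C.embed f).coeff 1 = 0 := by rw [← C.map_zero, C.coeff_embed, hf]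
    simp [C.map_zero, h0, orbitSum, act_zero, hf]
  · rw [← Fintype.sum_of_injective (fun z : Vec × Sgn => C.toFun z.1 z.2)
      (fun z w h => Prod.ext (C.inj _ _ _ _ h).1 (C.inj _ _ _ _ h).2)
      (fun z => f (act z.2⁻¹ y)) _ ?_ ?_]
    · rw [Fintype.sum_prod_type]
      dsimp only
      rw [Finset.sum_const, Finset.card_univ,
        show Fintype.card Vec = 27 from rfl, nsmul_eq_mul,
        ← Equiv.sum_comp (Equiv.inv Sgn)]
      simp [orbitSum]
    · intro g hg
      refine C.coeff_embed_eq_zero f fun hmem => hg ?_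
      obtain ⟨x, s, h⟩ := (C.mem_left_iff g).1
        (mem_of_conj_mem C hN hC ((C.mem_right_iff _).2 ⟨y, rfl⟩) (C.map_ne_one hy) hmem)
      exact ⟨(x, s), h⟩
    · rintro ⟨x, s⟩
      rw [C.conj_map, C.coeff_embed]

/-- The product of two class functions induced from functions on `T` can be computed inside `T`, if
their supports are disjoint. Terms outside `T` come from triples of elements of order `3` with
product `1`, one of them in `T`, that are not contained in `T`. All members of such a triple are
conjugate, which the disjointness of the supports excludes. -/
theorem coeff_conjSum_mul_conjSum [Fintype G] (C : Coordinates H T)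
    (hN : Subgroup.normalizer (T : Set G) = H)
    (hC : ∀ t ∈ T, t ≠ 1 → Subgroup.centralizer ({t} : Set G) ≤ H) {f h : Vec → ℂ} (hf : f 0 = 0)
    (hh : h 0 = 0) (hfh : ∀ x, orbitSum f x * orbitSum h x = 0) {x : Vec} (hx : x ≠ 0) :
    (conjSum (C.embed f) * conjSum (C.embed h)).coeff (C.toFun (-x) 1) =
      ∑ y, (27 * orbitSum f y) * (27 * orbitSum h (-y - x)) := by
  rw [coeff_mul_eq_sum, ← Fintype.sum_of_injective (fun y => C.toFun y 1) C.injective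
    (fun y => (27 * orbitSum f y) * (27 * orbitSum h (-y - x))) _ ?_ ?_]
  · intro y hy
    by_contra hne
    obtain ⟨hy0, hw0⟩ := ne_zero_and_ne_zero_of_mul hne
    rw [C.map_neg] at hw0
    set t := C.toFun x 1 with ht
    set w := y⁻¹ * t⁻¹ with hw
    have htT : t ∈ T := (C.mem_right_iff _).2 ⟨x, rfl⟩
    have ht1 : t ≠ 1 := C.map_ne_one hx
    have ht3 : t ^ 3 = 1 := C.pow_three x
    have hy3 := pow_three_of_coeff_conjSum_ne_zero C hy0
    have hw3 := pow_three_of_coeff_conjSum_ne_zero C hw0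
    have hyT : y ∉ T := fun hmem => hy ((C.mem_right_iff y).1 hmem)
    have hTmem : ∀ u ∈ H, u ^ 3 = 1 → u ∈ T := fun u hu h3 => C.mem_of_pow_three hu h3
    have hty : t * y = w⁻¹ := by rw [hw]; group
    have htw : t⁻¹ * w⁻¹ = y := by rw [hw]; group
    have c1 : IsConj t w := by
      have := mem_or_isConj_of_pow_three hTmem C.le hC htT ht1 ht3 hy3
        (by rw [hty, inv_pow, hw3, inv_one])
      rw [hty, inv_inv] at this
      exact this.resolve_right hyT
    have c2 : IsConj t⁻¹ y⁻¹ := by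
      have := mem_or_isConj_of_pow_three hTmem C.le hC (inv_mem htT) (inv_ne_one.2 ht1)
        (by rw [inv_pow, ht3, inv_one]) (y := w⁻¹) (by rw [inv_pow, hw3, inv_one])
        (by rw [htw, hy3])
      rw [htw] at this
      refine this.resolve_right fun hmem => hyT ?_
      rw [← htw]
      exact mul_mem (inv_mem htT) hmem
    have c3 : IsConj t y := by
      obtain ⟨c, hc⟩ := isConj_iff.1 c2
      refine isConj_iff.2 ⟨c, ?_⟩
      rw [← inv_inj, ← hc]; group
    rw [← coeff_conjSum_of_isConj _ c3, coeff_conjSum_embed C hN hC hf] at hy0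
    rw [← coeff_conjSum_of_isConj _ c1, coeff_conjSum_embed C hN hC hh] at hw0
    exact mul_ne_zero (right_ne_zero_of_mul hy0) (right_ne_zero_of_mul hw0) (hfh x)
  · intro y
    rw [← C.map_neg, ← C.map_add, coeff_conjSum_embed C hN hC hf, coeff_conjSum_embed C hN hC hh,
      sub_eq_add_neg]

/-- Evaluation of the bound `two_mul_card_le_sq` for `alphaSeed` and `gammaSeed`: all sums are sums
over the group `Vec`, with the same values as for `G = H`. -/
theorem two_mul_card_le [Fintype G] (C : Coordinates H T)
    (hN : Subgroup.normalizer (T : Set G) = H)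
    (hC : ∀ t ∈ T, t ≠ 1 → Subgroup.centralizer ({t} : Set G) ≤ H) :
    2 * Fintype.card G ≤ 54 ^ 2 := by
  refine two_mul_card_le_sq (C.embed_mem alphaSeed_mem) (C.embed_mem gammaSeed_mem) ?_ ?_
    (by norm_num) ?_
  · rw [← C.map_zero, C.coeff_embed, alphaSeed_zero]
  · rw [C.coeff_embed_mul, ← sum_alphaSeed_mul_orbitSum]
    simp only [coeff_conjSum_embed C hN hC alphaSeed_zero]
  · rw [C.coeff_embed_mul]
    push_cast
    rw [← sum_alphaSeed_mul_orbitSum_mul_orbitSum]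
    refine Finset.sum_congr rfl fun x _ => ?_
    rw [← Finset.mul_sum]
    by_cases hx : x = 0
    · rw [hx, alphaSeed_zero, zero_mul, zero_mul]
    · rw [coeff_conjSum_mul_conjSum C hN hC alphaSeed_zero gammaSeed_zero orbitSum_mul_orbitSum hx]

end

end

theorem theorem2 {G : Type*} [Group G] [Finite G] (H : Subgroup G)
    (hH : Nonempty (↥H ≃* ↥modelGroup)) (T : Sylow 3 ↥H)
    (hN : Subgroup.normalizer (((T : Subgroup ↥H).map H.subtype : Subgroup G) : Set G) = H)
    (hC : ∀ t ∈ (T : Subgroup ↥H).map H.subtype, t ≠ 1 →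
      Subgroup.centralizer ({t} : Set G) ≤ H) :
    H = ⊤ := by
  cases nonempty_fintype G
  obtain ⟨C⟩ := exists_coordinates H hH T
  refine (Subgroup.eq_top_iff' H).2 fun g => ?_
  by_contra hg
  have h1 := le_card_of_notMem C hN hC hg
  have h2 := two_mul_card_le C hN hC
  rw [Nat.card_eq_fintype_card] at h1
  omega
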